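/- Let $\mathcal N$ be a von Neumann algebra acting on a complex Hilbert space $\mathcal H$, equipped with a faithful normal semifinite trace $\tau:\mathcal N_+\to[0,\infty]$. Let $\mathcal K_{\mathcal N}$ be the ideal of $\tau$-compact operators, i.e. the norm closed two-sided ideal of $\mathcal N$ generated by the projections $E\in\mathcal N$ with $\tau(E)<\infty$. Let $P,Q\in\mathcal N$ be projections (not necessarily infinite or equivalent). For $T\in P\mathcal N Q$ let $N_T^Q$ be the projection onto $\ker(T)\cap Q(\mathcal H)$ and $N_{T^*}^P$ the projection onto $\ker(T^*)\cap P(\mathcal H)$. The operator $T\in P\mathcal NQ$ is called $(P\cdot Q)$-Fredholm if (i) $\tau(N_T^Q)<\infty$ and $\tau(N_{T^*}^P)<\infty$, and (ii) there is a projection $E\in\mathcal N$ with $E\le P$, $\tau(E)<\infty$ and $\operatorname{range}(P-E)\subseteq\operatorname{range}(T)$. In this case its $(P\cdot Q)$-index is the real number $$\operatorname{Ind}(T)=\tau(N_T^Q)-\tau(N_{T^*}^P).$$ **Corollary 3.8 (Invariance properties of the $(P\cdot Q)$-index).** Let $T\in P\mathcal N Q$ be $(P\cdot Q)$-Fredholm.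 1. There exists $\delta>0$ such that every $S\in P\mathcal N Q$ with $\|T-S\|<\delta$ is $(P\cdot Q)$-Fredholm and satisfies $\operatorname{Ind}(S)=\operatorname{Ind}(T)$. 2. For every $k\in P\mathcal K_{\mathcal N}Q$, the operator $T+k$ is $(P\cdot Q)$-Fredholm and $\operatorname{Ind}(T+k)=\operatorname{Ind}(T)$. -/

import Mathlib

open scoped ENNReal NNReal

noncomputable section

namespace SkewFredholm

variable {H : Type*} [NormedAddCommGroup H] [InnerProductSpace ℂ H] [CompleteSpace H]

/-- A faithful normal semifinite trace on a von Neumann algebra `N` acting on `H`: a map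
`N₊ → [0, ∞]` with the properties below. It is written as a function on all bounded operators,
but only its values on the positive cone `N₊` are constrained and only these are ever used.
The order is the Loewner order of operators. -/
structure FNSTrace (N : VonNeumannAlgebra H) where
  /-- The values of the trace. -/
  toFun : (H →L[ℂ] H) → ℝ≥0∞
  /-- Additivity on `N₊`. -/
  map_add : ∀ x ∈ N, ∀ y ∈ N, 0 ≤ x → 0 ≤ y → toFun (x + y) = toFun x + toFun y
  /-- Positive homogeneity on `N₊` (with `0 * ∞ = 0`, so that the trace of `0` is `0`). -/
  map_smul : ∀ (c : ℝ≥0), ∀ x ∈ N, 0 ≤ x → toFun ((c : ℂ) • x) = (c : ℝ≥0∞) * toFun x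
  /-- The trace property. -/
  map_star_mul : ∀ x ∈ N, toFun (star x * x) = toFun (x * star x)
  /-- Faithfulness. -/
  faithful : ∀ x ∈ N, 0 ≤ x → toFun x = 0 → x = 0
  /-- Normality: the trace commutes with suprema of bounded upward directed families in `N₊`. -/
  normal : ∀ D : Set (H →L[ℂ] H), (∀ y ∈ D, y ∈ N ∧ 0 ≤ y) → D.Nonempty →
    DirectedOn (· ≤ ·) D → ∀ x ∈ N, IsLUB D x → toFun x = ⨆ y ∈ D, toFun y
  /-- Semifiniteness: every nonzero element of `N₊` dominates a nonzero element of `N₊` of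
  finite trace. -/
  semifinite : ∀ x ∈ N, 0 ≤ x → x ≠ 0 → ∃ y ∈ N, 0 ≤ y ∧ y ≤ x ∧ y ≠ 0 ∧ toFun y < ∞

instance (N : VonNeumannAlgebra H) : CoeFun (FNSTrace N) (fun _ => (H →L[ℂ] H) → ℝ≥0∞) :=
  ⟨FNSTrace.toFun⟩

/-- `E` is a projection (self-adjoint idempotent) of the von Neumann algebra `N`. -/
def IsProj (N : VonNeumannAlgebra H) (E : H →L[ℂ] H) : Prop :=
  E ∈ N ∧ IsStarProjection E

/-- The skew-corner `P 𝒮 Q = {P A Q : A ∈ 𝒮}` of a set `𝒮` of operators. -/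
def skewCorner (P Q : H →L[ℂ] H) (𝒮 : Set (H →L[ℂ] H)) : Set (H →L[ℂ] H) :=
  {T | ∃ A ∈ 𝒮, T = P * A * Q}

/-- The `τ`-compact operators of `N`: the norm closed two-sided ideal of `N` generated by the
projections `E ∈ N` with `τ(E) < ∞`, i.e. the norm closure of the linear span of the products
`a E b` with `a, b ∈ N`. -/
def compacts {N : VonNeumannAlgebra H} (τ : FNSTrace N) : Set (H →L[ℂ] H) :=
  closure (Submodule.span ℂ
    {x : H →L[ℂ] H | ∃ a ∈ N, ∃ b ∈ N, ∃ E, IsProj N E ∧ τ E < ∞ ∧ x = a * E * b} :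
      Set (H →L[ℂ] H))

/-- The orthogonal projection `N_T^Q` of `H` onto `ker(T) ∩ Q(H)`. (For a projection `Q` this
subspace is closed, so that taking the closure changes nothing.) -/
def kerProj (Q T : H →L[ℂ] H) : H →L[ℂ] H :=
  (LinearMap.ker T.toLinearMap ⊓ LinearMap.range Q.toLinearMap).topologicalClosure.starProjection

/-- `T` is a `(P·Q)`-Fredholm element of `P N Q`. -/
def IsFredholm {N : VonNeumannAlgebra H} (τ : FNSTrace N) (P Q T : H →L[ℂ] H) : Prop :=
  T ∈ skewCorner P Q (N : Set (H →L[ℂ] H)) ∧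
  τ (kerProj Q T) < ∞ ∧ τ (kerProj P (star T)) < ∞ ∧
  ∃ E, IsProj N E ∧ E ≤ P ∧ τ E < ∞ ∧
    LinearMap.range (P - E).toLinearMap ≤ LinearMap.range T.toLinearMap

/-- The `(P·Q)`-index `τ(N_T^Q) - τ(N_{T*}^P)`, meaningful when `T` is `(P·Q)`-Fredholm (both
traces are then finite). -/
def index {N : VonNeumannAlgebra H} (τ : FNSTrace N) (P Q T : H →L[ℂ] H) : ℝ :=
  (τ (kerProj Q T)).toReal - (τ (kerProj P (star T))).toReal

end SkewFredholm

end

/-!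
# Invariance of the index in a skew-corner

The dimension `dim τ K` of an affiliated subspace `K` is the trace of the projection onto its
closure. It is additive along orthogonal decompositions and satisfies a rank-nullity theorem
(`dim_eq_ker_add_map`). Rank-nullity reduces to the equality of the traces of the range and
support projections of `x ∈ N` (`dim_range`), which is obtained without polar decomposition: for
`y = x (x* x + ε)^(-1/2)` the operators `y* y` and `y y*` have the same trace, and as `ε ↓ 0` they
increase to the support projection of `x` and to its range projection, so normality applies.

The index is computed on a *regular subspace*: a closed affiliated `L ≤ Q H` on which `T` is
bounded below and such that `L` in `Q H` and `T L` in `P H` have finite codimension. Every Fredholm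
operator has one (`IsFredholm.exists_isRegularSubspace`); conversely an operator with a regular
subspace `L` is Fredholm, and its index is the codimension of `L` minus that of `T L`
(`IsRegularSubspace.index_eq`), whatever the choice of `L`. Both invariance properties follow by
using one subspace for two operators.

* If `S` is near `T`, then `S` is still bounded below on `L`, and `T L` and `S L` have the same
  codimension because neither contains a nonzero vector orthogonal to the other.
* If `F` has finite-dimensional range, then `L ⊓ ker F` is again regular for `T`, and `T` and
  `T + F` agree on it.

A compact perturbation is the sum of one of small norm and one of finite-dimensional range.
-/

open scoped InnerProductSpace
open Filter Topology

namespace SkewFredholm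

variable {H : Type*} [NormedAddCommGroup H] [InnerProductSpace ℂ H]

/-! ### Operators bounded below on a subspace -/

section BoundedBelow

variable {L : Submodule ℂ H} {P S T : H →L[ℂ] H}

lemma disjoint_ker_of_bound (hb : ∃ c : ℝ, 0 < c ∧ ∀ v ∈ L, c * ‖v‖ ≤ ‖T v‖) {v : H}
    (hv : v ∈ L) (hTv : T v = 0) : v = 0 := by
  obtain ⟨c, hc, hb⟩ := hb
  have := hb v hv
  rw [hTv, norm_zero] at this
  exact norm_le_zero_iff.1 (nonpos_of_mul_nonpos_right this hc)

lemma map_le_range (hPT : P * T = T) : L.map T.toLinearMap ≤ P.range := by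
  rintro _ ⟨v, -, rfl⟩
  exact ⟨T v, congrArg (fun z : H →L[ℂ] H => z v) hPT⟩

/-- If `S` is close to `T` relative to the lower bound of `T` on `L`, then no nonzero vector of
`T L` is orthogonal to `S L`. -/
lemma eq_zero_of_mem_map_of_orthogonal {c : ℝ} (hb : ∀ v ∈ L, c * ‖v‖ ≤ ‖T v‖)
    (hST : ‖T - S‖ < c) {v : H} (hv : v ∈ L.map T.toLinearMap)
    (hvS : v ∈ (L.map S.toLinearMap)ᗮ) : v = 0 := by
  obtain ⟨l, hl, rfl⟩ := hv
  change T l = 0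
  have h0 : ⟪S l, T l⟫_ℂ = 0 := hvS _ ⟨l, hl, rfl⟩
  have h1 : ‖T l‖ * ‖T l‖ ≤ ‖T - S‖ * ‖l‖ * ‖T l‖ := by
    calc ‖T l‖ * ‖T l‖ = ‖⟪(T - S) l, T l⟫_ℂ‖ := by
          rw [sub_apply, inner_sub_left, h0, sub_zero,
            inner_self_eq_norm_sq_to_K]
          simp [sq]
      _ ≤ ‖(T - S) l‖ * ‖T l‖ := norm_inner_le_norm _ _
      _ ≤ ‖T - S‖ * ‖l‖ * ‖T l‖ := by
          gcongr
          exact (T - S).le_opNorm l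
  by_contra hne
  have hTl : 0 < ‖T l‖ := norm_pos_iff.2 hne
  have h2 : ‖T l‖ ≤ ‖T - S‖ * ‖l‖ := le_of_mul_le_mul_right h1 hTl
  have hl0 : 0 < ‖l‖ := by
    refine norm_pos_iff.2 fun h => hne ?_
    rw [h, map_zero]
  nlinarith [hb l hl]

end BoundedBelow

variable [CompleteSpace H]

/-! ### Support projections as increasing limits -/

/-- The Yosida-type approximation `a (a + ε)⁻¹` of the support projection of a positive
operator `a`. -/
noncomputable def yosida (ε : ℝ) (a : H →L[ℂ] H) : H →L[ℂ] H :=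
  cfc (fun t : ℝ => t / (t + ε)) a

/-- The square root `(a + ε)^(-1/2)` of the resolvent of a positive operator `a`. -/
noncomputable def sqrtResolvent (ε : ℝ) (a : H →L[ℂ] H) : H →L[ℂ] H :=
  cfc (fun t : ℝ => (√(t + ε))⁻¹) a

section Yosida

variable {ε : ℝ} {a : H →L[ℂ] H}

lemma continuousOn_yosida (hε : 0 < ε) (ha : 0 ≤ a) :
    ContinuousOn (fun t : ℝ => t / (t + ε)) (spectrum ℝ a) :=
  continuousOn_id.div (by fun_prop) fun t ht =>
    (add_pos_of_nonneg_of_pos (spectrum_nonneg_of_nonneg ha ht) hε).ne'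

lemma continuousOn_sqrtResolvent (hε : 0 < ε) (ha : 0 ≤ a) :
    ContinuousOn (fun t : ℝ => (√(t + ε))⁻¹) (spectrum ℝ a) :=
  ContinuousOn.inv₀ (by fun_prop) fun t ht =>
    (Real.sqrt_pos.2 (add_pos_of_nonneg_of_pos (spectrum_nonneg_of_nonneg ha ht) hε)).ne'

lemma star_sqrtResolvent (ε : ℝ) (a : H →L[ℂ] H) :
    star (sqrtResolvent ε a) = sqrtResolvent ε a :=
  (cfc_predicate (p := IsSelfAdjoint) (fun t : ℝ => (√(t + ε))⁻¹) a).star_eq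

lemma sqrtResolvent_mul_self_mul (hε : 0 < ε) (ha : 0 ≤ a) :
    sqrtResolvent ε a * sqrtResolvent ε a * a = yosida ε a := by
  have hc := continuousOn_sqrtResolvent hε ha
  have hsa : IsSelfAdjoint a := IsSelfAdjoint.of_nonneg ha
  calc sqrtResolvent ε a * sqrtResolvent ε a * a
      = cfc (fun t : ℝ => (√(t + ε))⁻¹ * (√(t + ε))⁻¹ * t) a := by
        rw [cfc_mul (fun t : ℝ => (√(t + ε))⁻¹ * (√(t + ε))⁻¹) (fun t => t) a (hc.mul hc),
          cfc_mul _ _ a hc hc, cfc_id' ℝ a]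
        rfl
    _ = yosida ε a := by
        refine cfc_congr fun t ht => ?_
        have h0 := add_pos_of_nonneg_of_pos (spectrum_nonneg_of_nonneg ha ht) hε
        have : (√(t + ε))⁻¹ * (√(t + ε))⁻¹ = (t + ε)⁻¹ := by
          rw [← mul_inv, Real.mul_self_sqrt h0.le]
        simp only [this]
        ring

lemma commute_sqrtResolvent (ε : ℝ) (a : H →L[ℂ] H) : Commute (sqrtResolvent ε a) a :=
  (Commute.refl a).cfc_real _

lemma sqrtResolvent_mul_mul_self (hε : 0 < ε) (ha : 0 ≤ a) :
    sqrtResolvent ε a * a * sqrtResolvent ε a = yosida ε a := by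
  rw [← sqrtResolvent_mul_self_mul hε ha, mul_assoc, ← (commute_sqrtResolvent ε a).eq, mul_assoc]

lemma sqrtResolvent_mul_self_mul_add (hε : 0 < ε) (ha : 0 ≤ a) :
    sqrtResolvent ε a * sqrtResolvent ε a * (a + ε • 1) = 1 := by
  have hc := continuousOn_sqrtResolvent hε ha
  have hsa : IsSelfAdjoint a := IsSelfAdjoint.of_nonneg ha
  have h1 : a + ε • (1 : H →L[ℂ] H) = cfc (fun t : ℝ => t + ε) a := by
    rw [cfc_add_const ε (fun t => t) a, cfc_id' ℝ a, Algebra.algebraMap_eq_smul_one]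
  rw [h1, ← cfc_one ℝ a]
  unfold sqrtResolvent
  rw [← cfc_mul _ _ a hc hc, ← cfc_mul (fun t : ℝ => (√(t + ε))⁻¹ * (√(t + ε))⁻¹) _ a (hc.mul hc) (by fun_prop)]
  refine cfc_congr fun t ht => ?_
  have h0 := add_pos_of_nonneg_of_pos (spectrum_nonneg_of_nonneg ha ht) hε
  have : (√(t + ε))⁻¹ * (√(t + ε))⁻¹ = (t + ε)⁻¹ := by
    rw [← mul_inv, Real.mul_self_sqrt h0.le]
  simp only [this, Pi.one_apply]
  exact inv_mul_cancel₀ h0.ne'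

/-- For `y = x (x* x + ε)^(-1/2)`, the product `y y*` is the Yosida approximation of `x x*`; by
`star_mul_yosida`, `y* y` is that of `x* x`. -/
lemma yosida_mul_star (hε : 0 < ε) (x : H →L[ℂ] H) :
    (x * sqrtResolvent ε (star x * x)) * star (x * sqrtResolvent ε (star x * x)) =
      yosida ε (x * star x) := by
  set a := star x * x with ha'
  set c := x * star x with hc'
  have ha : 0 ≤ a := star_mul_self_nonneg x
  have hc : 0 ≤ c := mul_star_self_nonneg x
  set b := sqrtResolvent ε a with hb
  set d := sqrtResolvent ε c
  rw [star_mul, star_sqrtResolvent]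
  -- Both sides are solutions `z` of `z (c + ε) = c`, and `c + ε` is invertible.
  have hcomm : (c + ε • 1) * (d * d) = 1 := by
    have h := sqrtResolvent_mul_self_mul_add hε hc
    have h2 : Commute (d * d) (c + ε • 1) := by
      have h3 : Commute (d * d) c :=
        (commute_sqrtResolvent ε c).mul_left (commute_sqrtResolvent ε c)
      exact h3.add_right ((Commute.one_right _).smul_right ε)
    rw [← h2.eq, h]
  have key : x * b * (b * star x) * (c + ε • 1) = c := by
    have h1 : star x * (c + ε • 1) = (a + ε • 1) * star x := by
      simp only [hc', ha', mul_add, add_mul, mul_assoc, mul_smul_comm, smul_mul_assoc, mul_one,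
        one_mul]
    calc x * b * (b * star x) * (c + ε • 1) = x * (b * b * (star x * (c + ε • 1))) := by
          simp only [mul_assoc]
      _ = x * ((b * b * (a + ε • 1)) * star x) := by rw [h1]; simp only [mul_assoc]
      _ = c := by rw [sqrtResolvent_mul_self_mul_add hε ha, one_mul]
  calc x * b * (b * star x) = x * b * (b * star x) * ((c + ε • 1) * (d * d)) := by
        rw [hcomm, mul_one]
    _ = c * (d * d) := by rw [← mul_assoc, key]
    _ = d * d * c := ((commute_sqrtResolvent ε c).mul_left (commute_sqrtResolvent ε c)).eq.symm
    _ = yosida ε c := sqrtResolvent_mul_self_mul hε hc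

lemma star_mul_yosida (hε : 0 < ε) (x : H →L[ℂ] H) :
    star (x * sqrtResolvent ε (star x * x)) * (x * sqrtResolvent ε (star x * x)) =
      yosida ε (star x * x) := by
  rw [star_mul, star_sqrtResolvent, ← sqrtResolvent_mul_mul_self hε (star_mul_self_nonneg x)]
  simp only [mul_assoc]

lemma yosida_nonneg (hε : 0 < ε) (ha : 0 ≤ a) : 0 ≤ yosida ε a :=
  cfc_nonneg fun t ht =>
    have h := spectrum_nonneg_of_nonneg ha ht
    div_nonneg h (by positivity)

lemma norm_yosida_le (hε : 0 < ε) (ha : 0 ≤ a) : ‖yosida ε a‖ ≤ 1 := by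
  refine norm_cfc_le zero_le_one fun t ht => ?_
  have h : 0 ≤ t := spectrum_nonneg_of_nonneg ha ht
  rw [Real.norm_of_nonneg (by positivity)]
  exact div_le_one_of_le₀ (by linarith) (by positivity)

lemma yosida_anti {δ : ℝ} (hδ : 0 < δ) (hε : δ ≤ ε) (ha : 0 ≤ a) :
    yosida ε a ≤ yosida δ a := by
  refine cfc_mono (fun t ht => ?_) (continuousOn_yosida (hδ.trans_le hε) ha)
    (continuousOn_yosida hδ ha)
  have h : 0 ≤ t := spectrum_nonneg_of_nonneg ha ht
  exact div_le_div_of_nonneg_left h (by positivity) (by linarith)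

lemma yosida_mul_self (hε : 0 < ε) (ha : 0 ≤ a) : yosida ε a * a = a - ε • yosida ε a := by
  have h1 := sqrtResolvent_mul_self_mul_add hε ha
  have h2 := sqrtResolvent_mul_self_mul hε ha
  set r := sqrtResolvent ε a * sqrtResolvent ε a
  have h3 : r * a + ε • r = 1 := by rw [← h1, mul_add, mul_smul_comm, mul_one]
  rw [← h2]
  have : (r * a + ε • r) * a = a := by rw [h3, one_mul]
  rw [add_mul, smul_mul_assoc] at this
  exact eq_sub_of_add_eq this

lemma tendsto_yosida_apply (ha : 0 ≤ a) {v : H} (hv : v ∈ a.range.topologicalClosure) :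
    Tendsto (fun n : ℕ => yosida (1 / ((n : ℝ) + 1)) a v) atTop (𝓝 v) := by
  rw [Metric.tendsto_atTop]
  intro η hη
  obtain ⟨_, ⟨w, rfl⟩, hw⟩ := Metric.mem_closure_iff.1 hv (η / 3) (by positivity)
  obtain ⟨n₀, hn₀⟩ := exists_nat_gt (‖w‖ / (η / 3))
  refine ⟨n₀, fun n hn => ?_⟩
  set ε : ℝ := 1 / ((n : ℝ) + 1) with hεdef
  have hε : 0 < ε := by positivity
  have hf := norm_yosida_le hε ha
  have hfv : ∀ u, ‖yosida ε a u‖ ≤ ‖u‖ := fun u => by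
    simpa using (yosida ε a).le_of_opNorm_le hf u
  have hεw : ε * ‖w‖ < η / 3 := by
    rw [div_lt_iff₀ (by positivity)] at hn₀
    have : (n₀ : ℝ) ≤ n := by exact_mod_cast hn
    rw [hεdef, one_div_mul_eq_div, div_lt_iff₀ (by positivity)]
    nlinarith
  have e1 : yosida ε a v - v =
      yosida ε a (v - a w) - ε • yosida ε a w - (v - a w) := by
    have := congrArg (fun z : H →L[ℂ] H => z w) (yosida_mul_self hε ha)
    simp only [mul_apply_eq_comp, sub_apply,
      smul_apply] at this
    rw [map_sub, this]
    abel
  have hw' : ‖v - a w‖ < η / 3 := by rw [← dist_eq_norm]; exact hw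
  rw [dist_eq_norm, e1]
  calc ‖yosida ε a (v - a w) - ε • yosida ε a w - (v - a w)‖
      ≤ ‖yosida ε a (v - a w)‖ + ‖ε • yosida ε a w‖ + ‖v - a w‖ :=
        (norm_sub_le _ _).trans (add_le_add_left (norm_sub_le _ _) _)
    _ ≤ ‖v - a w‖ + ε * ‖w‖ + ‖v - a w‖ := by
        gcongr
        · exact hfv _
        · rw [norm_smul, Real.norm_of_nonneg hε.le]
          gcongr
          exact hfv w
    _ < η := by linarith

lemma tendsto_yosida_apply_support (ha : 0 ≤ a) (v : H) :
    Tendsto (fun n : ℕ => yosida (1 / ((n : ℝ) + 1)) a v) atTop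
      (𝓝 (a.kerᗮ.starProjection v)) := by
  have hsa : IsSelfAdjoint a := IsSelfAdjoint.of_nonneg ha
  have hcl : a.kerᗮ = a.range.topologicalClosure := by
    rw [ContinuousLinearMap.orthogonal_ker, ← ContinuousLinearMap.star_eq_adjoint, hsa.star_eq]
  have hmem : a.kerᗮ.starProjection v ∈ a.range.topologicalClosure :=
    hcl ▸ Submodule.starProjection_apply_mem _ v
  refine (tendsto_yosida_apply ha hmem).congr fun n => ?_
  have hε : (0 : ℝ) < 1 / ((n : ℝ) + 1) := by positivity
  have hk : v - a.kerᗮ.starProjection v ∈ a.ker := by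
    have := Submodule.sub_starProjection_mem_orthogonal (K := a.kerᗮ) v
    rwa [Submodule.orthogonal_orthogonal_eq_closure, a.isClosed_ker.submodule_topologicalClosure_eq]
      at this
  have h0 : yosida (1 / ((n : ℝ) + 1)) a (v - a.kerᗮ.starProjection v) = 0 := by
    rw [← sqrtResolvent_mul_self_mul hε ha, mul_apply_eq_comp,
      show a (v - a.kerᗮ.starProjection v) = 0 from hk, map_zero]
  rw [map_sub, sub_eq_zero] at h0
  exact h0.symm

end Yosida

lemma le_iff_re_inner_le {x y : H →L[ℂ] H} (hx : IsSelfAdjoint x) (hy : IsSelfAdjoint y) :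
    x ≤ y ↔ ∀ v, RCLike.re ⟪x v, v⟫_ℂ ≤ RCLike.re ⟪y v, v⟫_ℂ := by
  rw [ContinuousLinearMap.le_def, ContinuousLinearMap.isPositive_def']
  simp only [hy.sub hx, true_and, ContinuousLinearMap.reApplyInnerSelf_apply,
    sub_apply, inner_sub_left, map_sub, sub_nonneg]

/-- The support projection of a positive operator is the supremum of its Yosida
approximations. -/
lemma isLUB_yosida {a : H →L[ℂ] H} (ha : 0 ≤ a) :
    IsLUB (Set.range fun n : ℕ => yosida (1 / ((n : ℝ) + 1)) a) a.kerᗮ.starProjection := by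
  have hpos : ∀ n : ℕ, (0 : ℝ) < 1 / ((n : ℝ) + 1) := fun n => by positivity
  have hsa : ∀ n : ℕ, IsSelfAdjoint (yosida (1 / ((n : ℝ) + 1)) a) :=
    fun n => IsSelfAdjoint.of_nonneg (yosida_nonneg (hpos n) ha)
  have hR := isSelfAdjoint_starProjection a.kerᗮ
  have hlim : ∀ v, Tendsto (fun n : ℕ => RCLike.re ⟪yosida (1 / ((n : ℝ) + 1)) a v, v⟫_ℂ) atTop
      (𝓝 (RCLike.re ⟪a.kerᗮ.starProjection v, v⟫_ℂ)) := fun v =>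
    (RCLike.continuous_re.tendsto _).comp
      ((tendsto_yosida_apply_support ha v).inner tendsto_const_nhds)
  constructor
  · rintro _ ⟨n, rfl⟩
    rw [le_iff_re_inner_le (hsa n) hR]
    intro v
    refine Monotone.ge_of_tendsto (fun m k hmk => ?_) (hlim v) n
    exact (le_iff_re_inner_le (hsa m) (hsa k)).1
      (yosida_anti (hpos k) (one_div_le_one_div_of_le (by positivity) (by gcongr)) ha) v
  · intro y hy
    have hy0 : IsSelfAdjoint y :=
      IsSelfAdjoint.of_nonneg ((yosida_nonneg (hpos 0) ha).trans (hy ⟨0, rfl⟩))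
    rw [le_iff_re_inner_le hR hy0]
    intro v
    exact le_of_tendsto' (hlim v) fun n => (le_iff_re_inner_le (hsa n) hy0).1 (hy ⟨n, rfl⟩) v

/-! ### Affiliated subspaces -/

section Dimension

/-- A subspace `K` is affiliated with `N` if it is invariant under the commutant of `N`; for
closed `K` this says that the orthogonal projection onto `K` lies in `N`. -/
def IsAffiliated (N : VonNeumannAlgebra H) (K : Submodule ℂ H) : Prop :=
  ∀ y ∈ N.commutant, ∀ v ∈ K, y v ∈ K

variable {N : VonNeumannAlgebra H} {K L : Submodule ℂ H} {x y : H →L[ℂ] H}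

lemma apply_comm (hx : x ∈ N) (hy : y ∈ N.commutant) (v : H) : x (y v) = y (x v) :=
  congrArg (fun z : H →L[ℂ] H => z v) (VonNeumannAlgebra.mem_commutant_iff.1 hy x hx)

namespace IsAffiliated

lemma topologicalClosure (hK : IsAffiliated N K) : IsAffiliated N K.topologicalClosure :=
  fun y hy _ hv => map_mem_closure y.continuous hv fun w hw => hK y hy w hw

lemma orthogonal (hK : IsAffiliated N K) : IsAffiliated N Kᗮ := fun y hy v hv w hw => by
  rw [← ContinuousLinearMap.adjoint_inner_left, ← ContinuousLinearMap.star_eq_adjoint]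
  exact hv _ (hK _ (star_mem hy) w hw)

lemma inf (hK : IsAffiliated N K) (hL : IsAffiliated N L) : IsAffiliated N (K ⊓ L) :=
  fun y hy v hv => ⟨hK y hy v hv.1, hL y hy v hv.2⟩

lemma map (hK : IsAffiliated N K) (hx : x ∈ N) : IsAffiliated N (K.map x.toLinearMap) := by
  rintro y hy _ ⟨v, hv, rfl⟩
  exact ⟨y v, hK y hy v hv, apply_comm hx hy v⟩

lemma ker (hx : x ∈ N) : IsAffiliated N x.ker := fun y hy v hv => by
  have hv' : x v = 0 := hv
  change x (y v) = 0
  rw [apply_comm hx hy, hv', map_zero]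

lemma range (hx : x ∈ N) : IsAffiliated N x.range := by
  rintro y hy _ ⟨v, rfl⟩
  exact ⟨y v, apply_comm hx hy v⟩

lemma starProjection_mem [K.HasOrthogonalProjection] (hK : IsAffiliated N K) :
    K.starProjection ∈ N := by
  rw [VonNeumannAlgebra.IsStarProjection.mem_iff isStarProjection_starProjection]
  intro y hy v hv
  rw [Submodule.range_starProjection] at hv ⊢
  exact hK y hy v hv

end IsAffiliated

lemma yosida_mem {a : H →L[ℂ] H} (ha : a ∈ N) (ε : ℝ) : yosida ε a ∈ N := by
  rw [← VonNeumannAlgebra.commutant_commutant N, VonNeumannAlgebra.mem_commutant_iff]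
  intro y hy
  have : Commute a y := VonNeumannAlgebra.mem_commutant_iff.1 hy a ha
  exact (this.cfc_real _).eq.symm

lemma sqrtResolvent_mem {a : H →L[ℂ] H} (ha : a ∈ N) (ε : ℝ) : sqrtResolvent ε a ∈ N := by
  rw [← VonNeumannAlgebra.commutant_commutant N, VonNeumannAlgebra.mem_commutant_iff]
  intro y hy
  have : Commute a y := VonNeumannAlgebra.mem_commutant_iff.1 hy a ha
  exact (this.cfc_real _).eq.symm

/-! ### The dimension function of a trace -/

/-- The dimension of a subspace with respect to the trace `τ`: the trace of the projection onto
its closure. It is meaningful for affiliated subspaces. -/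
noncomputable def dim (τ : FNSTrace N) (K : Submodule ℂ H) : ℝ≥0∞ :=
  τ K.topologicalClosure.starProjection

variable (τ : FNSTrace N)

lemma dim_topologicalClosure (K : Submodule ℂ H) : dim τ K.topologicalClosure = dim τ K := by
  have h : K.topologicalClosure.topologicalClosure = K.topologicalClosure :=
    (K.isClosed_topologicalClosure).submodule_topologicalClosure_eq
  unfold dim
  congr 1
  exact Submodule.starProjection_inj.2 h

lemma dim_eq_of_hasOrthogonalProjection (K : Submodule ℂ H) [K.HasOrthogonalProjection] :
    dim τ K = τ K.starProjection := by
  unfold dim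
  congr 1
  exact Submodule.starProjection_inj.2
    (K.orthogonal_orthogonal_eq_closure.symm.trans K.orthogonal_orthogonal)

lemma trace_zero : τ 0 = 0 := by
  simpa using τ.map_smul 0 0 (zero_mem N) le_rfl

@[simp] lemma dim_bot : dim τ (⊥ : Submodule ℂ H) = 0 := by
  rw [dim_eq_of_hasOrthogonalProjection, Submodule.starProjection_bot, trace_zero]

lemma dim_range_of_isProj {E : H →L[ℂ] H} (hE : IsProj N E) : dim τ E.range = τ E := by
  have h := isStarProjection_iff_eq_starProjection.1 hE.2
  obtain ⟨U, _, rfl⟩ := h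
  rw [Submodule.range_starProjection, dim_eq_of_hasOrthogonalProjection]

/-- The support projection of a positive operator of `N` has as trace the supremum of the traces of
the Yosida approximations. -/
lemma dim_orthogonal_ker_of_nonneg {a : H →L[ℂ] H} (haN : a ∈ N) (ha : 0 ≤ a) :
    dim τ a.kerᗮ = ⨆ n : ℕ, τ (yosida (1 / ((n : ℝ) + 1)) a) := by
  have hpos : ∀ n : ℕ, (0 : ℝ) < 1 / ((n : ℝ) + 1) := fun n => by positivity
  rw [dim_eq_of_hasOrthogonalProjection, τ.normal
    (Set.range fun n : ℕ => yosida (1 / ((n : ℝ) + 1)) a) ?_ (Set.range_nonempty _) ?_ _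
    (IsAffiliated.ker haN).orthogonal.starProjection_mem (isLUB_yosida ha), iSup_range]
  · rintro _ ⟨n, rfl⟩
    exact ⟨yosida_mem haN _, yosida_nonneg (hpos n) ha⟩
  · refine directedOn_range.2 (Monotone.directed_le fun m k hmk => ?_)
    exact yosida_anti (hpos k) (one_div_le_one_div_of_le (by positivity) (by gcongr)) ha

/-- The initial and the final projection of an operator of `N` have the same trace. -/
lemma dim_range (hx : x ∈ N) : dim τ x.range = dim τ x.kerᗮ := by
  have h1 : (star x * x).ker = x.ker := x.ker_adjoint_comp_self
  have h2 : (x * star x).ker = (star x).ker := x.ker_self_comp_adjoint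
  have h3 : (star x).kerᗮ = x.range.topologicalClosure := by
    rw [ContinuousLinearMap.orthogonal_ker, ← ContinuousLinearMap.star_eq_adjoint, star_star]
  rw [← dim_topologicalClosure, ← h3, ← h2, ← h1,
    dim_orthogonal_ker_of_nonneg τ (mul_mem (star_mem hx) hx) (star_mul_self_nonneg x),
    dim_orthogonal_ker_of_nonneg τ (mul_mem hx (star_mem hx)) (mul_star_self_nonneg x)]
  refine iSup_congr fun n => ?_
  have hε : (0 : ℝ) < 1 / ((n : ℝ) + 1) := by positivity
  rw [← yosida_mul_star hε, ← star_mul_yosida hε]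
  exact (τ.map_star_mul _ (mul_mem hx (sqrtResolvent_mem (mul_mem (star_mem hx) hx) _))).symm

lemma starProjection_nonneg (K : Submodule ℂ H) [K.HasOrthogonalProjection] :
    0 ≤ K.starProjection :=
  isStarProjection_starProjection.nonneg

/-- Additivity of the dimension along an orthogonal decomposition. -/
lemma dim_eq_add_inf_orthogonal (hK : IsAffiliated N K) (hL : IsAffiliated N L)
    (hKL : K ≤ L) (hLc : IsClosed (L : Set H)) : dim τ L = dim τ K + dim τ (L ⊓ Kᗮ) := by
  have : CompleteSpace L := hLc.completeSpace_coe
  have : CompleteSpace (L ⊓ Kᗮ : Submodule ℂ H) :=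
    (hLc.inter K.isClosed_orthogonal).completeSpace_coe
  have hKL' : K.topologicalClosure ≤ L := K.topologicalClosure_minimal hKL hLc
  rw [← dim_topologicalClosure τ K, dim_eq_of_hasOrthogonalProjection τ L,
    dim_eq_of_hasOrthogonalProjection τ K.topologicalClosure,
    dim_eq_of_hasOrthogonalProjection τ (L ⊓ Kᗮ),
    ← τ.map_add _ hK.topologicalClosure.starProjection_mem _
      (hL.inf hK.orthogonal).starProjection_mem (starProjection_nonneg _)
      (starProjection_nonneg _)]
  congr 1
  ext v
  have key : (L ⊓ Kᗮ).starProjection v =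
      L.starProjection v - K.topologicalClosure.starProjection v := by
    refine Submodule.eq_starProjection_of_mem_of_inner_eq_zero ⟨?_, ?_⟩ fun w hw => ?_
    · exact sub_mem (Submodule.starProjection_apply_mem _ _)
        (hKL' (Submodule.starProjection_apply_mem _ _))
    · intro w hw
      have h1 := Submodule.starProjection_inner_eq_zero (K := L) v w (hKL hw)
      have h2 := Submodule.starProjection_inner_eq_zero (K := K.topologicalClosure) v w
        (K.le_topologicalClosure hw)
      have : ⟪L.starProjection v - K.topologicalClosure.starProjection v, w⟫_ℂ = 0 := by
        rw [← sub_sub_sub_cancel_left _ _ v, inner_sub_left, h1, h2, sub_zero]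
      exact inner_eq_zero_symm.1 this
    · have h1 := Submodule.starProjection_inner_eq_zero (K := L) v w hw.1
      have h2 : ⟪K.topologicalClosure.starProjection v, w⟫_ℂ = 0 := by
        have hw' : w ∈ K.topologicalClosureᗮ := by
          rw [Submodule.orthogonal_closure]
          exact hw.2
        exact hw' _ (Submodule.starProjection_apply_mem _ _)
      rw [← sub_add, inner_add_left, h1, h2, add_zero]
  rw [add_apply, key]
  abel

lemma dim_mono (hK : IsAffiliated N K) (hL : IsAffiliated N L) (hKL : K ≤ L) :
    dim τ K ≤ dim τ L := by
  rw [← dim_topologicalClosure τ L, dim_eq_add_inf_orthogonal τ hK hL.topologicalClosure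
    (hKL.trans L.le_topologicalClosure) L.isClosed_topologicalClosure]
  exact le_self_add

/-- The rank-nullity theorem for the dimension function. -/
lemma dim_eq_ker_add_map (hK : IsAffiliated N K) (hKc : IsClosed (K : Set H)) (hx : x ∈ N) :
    dim τ K = dim τ (K ⊓ x.ker) + dim τ (K.map x.toLinearMap) := by
  have : CompleteSpace K := hKc.completeSpace_coe
  have hr : K.map x.toLinearMap = (x * K.starProjection).range := by
    ext w
    constructor
    · rintro ⟨v, hv, rfl⟩
      exact ⟨v, congrArg x (Submodule.starProjection_eq_self_iff.2 hv)⟩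
    · rintro ⟨v, rfl⟩
      exact ⟨K.starProjection v, Submodule.starProjection_apply_mem _ _, rfl⟩
  have hk : (x * K.starProjection).kerᗮ = K ⊓ (K ⊓ x.ker)ᗮ := by
    ext v
    constructor
    · intro hv
      refine ⟨?_, fun w hw => hv w ?_⟩
      · rw [← Submodule.orthogonal_orthogonal K]
        refine fun w hw => hv w ?_
        change x (K.starProjection w) = 0
        rw [(Submodule.starProjection_apply_eq_zero_iff _).2 hw, map_zero]
      · change x (K.starProjection w) = 0
        rw [Submodule.starProjection_eq_self_iff.2 hw.1]
        exact hw.2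
    · rintro ⟨hv1, hv2⟩ w hw
      have h1 := hv2 (K.starProjection w) ⟨Submodule.starProjection_apply_mem _ _, hw⟩
      rw [Submodule.inner_starProjection_left_eq_right,
        Submodule.starProjection_eq_self_iff.2 hv1] at h1
      exact h1
  rw [dim_eq_add_inf_orthogonal τ (hK.inf (IsAffiliated.ker hx)) hK inf_le_left hKc, hr,
    dim_range τ (mul_mem hx hK.starProjection_mem), hk]

lemma dim_map_le (hK : IsAffiliated N K) (hKc : IsClosed (K : Set H)) (hx : x ∈ N) :
    dim τ (K.map x.toLinearMap) ≤ dim τ K := by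
  rw [dim_eq_ker_add_map τ hK hKc hx]
  exact le_add_self

lemma dim_le_map (hK : IsAffiliated N K) (hKc : IsClosed (K : Set H)) (hx : x ∈ N)
    (hinj : K ⊓ x.ker = ⊥) : dim τ K ≤ dim τ (K.map x.toLinearMap) := by
  rw [dim_eq_ker_add_map τ hK hKc hx, hinj, dim_bot, zero_add]

end Dimension

section Fredholm

variable {N : VonNeumannAlgebra H} {τ : FNSTrace N} {K L : Submodule ℂ H}
  {P Q T S F x : H →L[ℂ] H}

/-! ### Skew-corners -/

lemma IsProj.mul_self (hP : IsProj N P) : P * P = P := hP.2.isIdempotentElem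

lemma IsProj.isClosed_range (hP : IsProj N P) : IsClosed (P.range : Set H) := by
  obtain ⟨U, _, rfl⟩ := isStarProjection_iff_eq_starProjection.1 hP.2
  rw [Submodule.range_starProjection, ← U.orthogonal_orthogonal]
  exact Uᗮ.isClosed_orthogonal

lemma IsProj.apply_of_mem (hP : IsProj N P) {v : H} (hv : v ∈ P.range) : P v = v := by
  obtain ⟨w, rfl⟩ := hv
  exact congrArg (fun z : H →L[ℂ] H => z w) hP.mul_self

lemma mem_skewCorner_iff (hP : IsProj N P) (hQ : IsProj N Q) :
    T ∈ skewCorner P Q (N : Set (H →L[ℂ] H)) ↔ T ∈ N ∧ P * T = T ∧ T * Q = T := by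
  constructor
  · rintro ⟨A, hA, rfl⟩
    refine ⟨mul_mem (mul_mem hP.1 hA) hQ.1, ?_, ?_⟩
    · rw [← mul_assoc, ← mul_assoc, hP.mul_self]
    · rw [mul_assoc, hQ.mul_self]
  · rintro ⟨hT, h1, h2⟩
    exact ⟨T, hT, by rw [h1, h2]⟩

lemma add_mem_skewCorner (hP : IsProj N P) (hQ : IsProj N Q)
    (hT : T ∈ skewCorner P Q (N : Set (H →L[ℂ] H)))
    (hS : S ∈ skewCorner P Q (N : Set (H →L[ℂ] H))) :
    T + S ∈ skewCorner P Q (N : Set (H →L[ℂ] H)) := by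
  rw [mem_skewCorner_iff hP hQ] at *
  refine ⟨add_mem hT.1 hS.1, ?_, ?_⟩
  · rw [mul_add, hT.2.1, hS.2.1]
  · rw [add_mul, hT.2.2, hS.2.2]

/-! ### Regular subspaces and the index -/

/-- A subspace on which `T` is invertible up to finite dimensions: a closed affiliated subspace
`L` of `Q H` such that `T` is bounded below on `L` and both `L` in `Q H` and `T L` in `P H` have
finite `τ`-codimension. -/
structure IsRegularSubspace (τ : FNSTrace N) (P Q T : H →L[ℂ] H) (L : Submodule ℂ H) : Prop where
  affiliated : IsAffiliated N L
  isClosed : IsClosed (L : Set H)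
  le_range : L ≤ Q.range
  bound : ∃ c : ℝ, 0 < c ∧ ∀ v ∈ L, c * ‖v‖ ≤ ‖T v‖
  dim_domain : dim τ (Q.range ⊓ Lᗮ) < ∞
  dim_codomain : dim τ (P.range ⊓ (L.map T.toLinearMap)ᗮ) < ∞

lemma isClosed_map_of_bound (hL : IsClosed (L : Set H))
    (hb : ∃ c : ℝ, 0 < c ∧ ∀ v ∈ L, c * ‖v‖ ≤ ‖T v‖) :
    IsClosed (L.map T.toLinearMap : Set H) := by
  obtain ⟨c, hc, hb⟩ := hb
  have : CompleteSpace L := hL.completeSpace_coe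
  set f : L →L[ℂ] H := T ∘L L.subtypeL
  have hf : AntilipschitzWith (c⁻¹).toNNReal f := by
    refine ContinuousLinearMap.antilipschitz_of_bound _ fun v => ?_
    rw [Real.coe_toNNReal _ (by positivity), ← div_eq_inv_mul, le_div_iff₀ hc, mul_comm]
    exact hb v v.2
  convert hf.isClosed_range f.uniformContinuous using 1
  ext w
  simp [f]

/-- The dimensions of the complements of a regular subspace and of its image differ from those of
the kernel and of the cokernel of `T` by the same amount. -/
lemma IsRegularSubspace.exists_dim_eq (hP : IsProj N P) (hQ : IsProj N Q)
    (hT : T ∈ skewCorner P Q (N : Set (H →L[ℂ] H))) (hL : IsRegularSubspace τ P Q T L) :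
    ∃ d : ℝ≥0∞, dim τ (Q.range ⊓ Lᗮ) = dim τ (T.ker ⊓ Q.range) + d ∧
      dim τ (P.range ⊓ (L.map T.toLinearMap)ᗮ) = d + dim τ ((star T).ker ⊓ P.range) := by
  obtain ⟨hTN, hPT, hTQ⟩ := (mem_skewCorner_iff hP hQ).1 hT
  have hMc := isClosed_map_of_bound hL.isClosed hL.bound
  have : CompleteSpace L := hL.isClosed.completeSpace_coe
  have : CompleteSpace (L.map T.toLinearMap) := hMc.completeSpace_coe
  have hMaff := hL.affiliated.map hTN
  have hPr := IsAffiliated.range hP.1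
  have hQr := IsAffiliated.range hQ.1
  set M := L.map T.toLinearMap with hM
  set A := Q.range ⊓ Lᗮ
  set y : H →L[ℂ] H := (1 - M.starProjection) * T with hy
  have hyN : y ∈ N := mul_mem (sub_mem (one_mem N) hMaff.starProjection_mem) hTN
  have hy_apply : ∀ v, y v = T v - M.starProjection (T v) := fun v => rfl
  have hA : IsAffiliated N A := hQr.inf hL.affiliated.orthogonal
  have hAc : IsClosed (A : Set H) := hQ.isClosed_range.inter L.isClosed_orthogonal
  have hyM : ∀ v, y v ∈ Mᗮ := fun v => Submodule.sub_starProjection_mem_orthogonal _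
  refine ⟨dim τ (A.map y.toLinearMap), ?_, ?_⟩
  · -- The projection along `L` identifies the kernel of `T` with that of `y` on `A`.
    rw [dim_eq_ker_add_map τ hA hAc hyN]
    congr 1
    have hN0 : IsAffiliated N (T.ker ⊓ Q.range) := (IsAffiliated.ker hTN).inf hQr
    have hx : (1 - L.starProjection) ∈ N :=
      sub_mem (one_mem N) hL.affiliated.starProjection_mem
    have hx_apply : ∀ v, (1 - L.starProjection) v = v - L.starProjection v := fun v => rfl
    rw [dim_eq_ker_add_map τ hN0 (T.isClosed_ker.inter hQ.isClosed_range) hx]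
    have h1 : (T.ker ⊓ Q.range) ⊓ (1 - L.starProjection).ker = ⊥ := by
      rw [eq_bot_iff]
      rintro v ⟨⟨hv1, -⟩, hv2⟩
      have hv3 : v - L.starProjection v = 0 := hv2
      refine disjoint_ker_of_bound hL.bound ?_ hv1
      rw [sub_eq_zero.1 hv3]
      exact Submodule.starProjection_apply_mem _ _
    rw [h1, dim_bot, zero_add]
    congr 1
    ext a
    constructor
    · rintro ⟨⟨haQ, haL⟩, hay⟩
      have hTa : T a - M.starProjection (T a) = 0 := hay
      have hTaM : T a ∈ M := by
        rw [sub_eq_zero.1 hTa]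
        exact Submodule.starProjection_apply_mem _ _
      obtain ⟨l, hl, hla⟩ := hTaM
      have hla' : T l = T a := hla
      refine ⟨a - l, ⟨?_, sub_mem haQ (hL.le_range hl)⟩, ?_⟩
      · change T (a - l) = 0
        rw [map_sub, hla', sub_self]
      · change (a - l) - L.starProjection (a - l) = a
        rw [map_sub, (Submodule.starProjection_apply_eq_zero_iff L).2 haL,
          Submodule.starProjection_eq_self_iff.2 hl]
        abel
    · rintro ⟨n, ⟨hn1, hn2⟩, rfl⟩
      have hn1' : T n = 0 := hn1
      have hm := Submodule.starProjection_apply_mem L n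
      refine ⟨⟨sub_mem hn2 (hL.le_range hm), Submodule.sub_starProjection_mem_orthogonal _⟩, ?_⟩
      change y (n - L.starProjection n) = 0
      rw [hy_apply, map_sub, hn1', zero_sub, map_neg, Submodule.starProjection_eq_self_iff.2
        (show T (L.starProjection n) ∈ M from ⟨_, hm, rfl⟩), sub_self]
  · have hle : A.map y.toLinearMap ≤ P.range ⊓ Mᗮ := by
      rintro _ ⟨a, ha, rfl⟩
      refine ⟨?_, hyM a⟩
      exact sub_mem (map_le_range (L := ⊤) hPT ⟨a, trivial, rfl⟩)
        (map_le_range hPT (Submodule.starProjection_apply_mem M (T a)))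
    rw [dim_eq_add_inf_orthogonal τ (hA.map hyN) (hPr.inf hMaff.orthogonal) hle
      (hP.isClosed_range.inter M.isClosed_orthogonal)]
    congr 2
    ext v
    constructor
    · rintro ⟨⟨hvP, hvM⟩, hvA⟩
      refine ⟨?_, hvP⟩
      change (star T) v = 0
      rw [← inner_self_eq_zero (𝕜 := ℂ)]
      -- It suffices that `v` is orthogonal to `T (Q u) = T u` for every `u`.
      have hTv : ∀ u, ⟪T u, v⟫_ℂ = 0 := fun u => by
        have hu : T u = T (Q u) := congrArg (fun z : H →L[ℂ] H => z u) hTQ.symm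
        set l := L.starProjection (Q u) with hl
        have hlL : l ∈ L := Submodule.starProjection_apply_mem _ _
        have ha : Q u - l ∈ A :=
          ⟨sub_mem ⟨u, rfl⟩ (hL.le_range hlL), Submodule.sub_starProjection_mem_orthogonal _⟩
        have h1 : ⟪T l, v⟫_ℂ = 0 := hvM _ ⟨l, hlL, rfl⟩
        have h2 : ⟪y (Q u - l), v⟫_ℂ = 0 := hvA _ ⟨_, ha, rfl⟩
        have h3 : ⟪M.starProjection (T (Q u - l)), v⟫_ℂ = 0 :=
          hvM _ (Submodule.starProjection_apply_mem _ _)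
        rw [hy_apply, inner_sub_left, h3, sub_zero, map_sub, inner_sub_left, h1, sub_zero] at h2
        rw [hu, h2]
      rw [ContinuousLinearMap.star_eq_adjoint, ContinuousLinearMap.adjoint_inner_right]
      exact hTv _
    · rintro ⟨hv, hvP⟩
      have hTv : ∀ u, ⟪T u, v⟫_ℂ = 0 := fun u => by
        rw [← ContinuousLinearMap.adjoint_inner_right, ← ContinuousLinearMap.star_eq_adjoint,
          show (star T) v = 0 from hv, inner_zero_right]
      have hvM : v ∈ Mᗮ := by
        rintro _ ⟨l, -, rfl⟩
        exact hTv l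
      refine ⟨⟨hvP, hvM⟩, ?_⟩
      rintro _ ⟨a, -, rfl⟩
      change ⟪y a, v⟫_ℂ = 0
      rw [hy_apply, inner_sub_left, hTv, hvM _ (Submodule.starProjection_apply_mem _ _), sub_zero]

/-- An operator with a regular subspace is Fredholm: the complement of the image is a projection of
finite trace off which `T` is onto. -/
lemma IsRegularSubspace.isFredholm (hP : IsProj N P) (hQ : IsProj N Q)
    (hT : T ∈ skewCorner P Q (N : Set (H →L[ℂ] H))) (hL : IsRegularSubspace τ P Q T L) :
    IsFredholm τ P Q T := by
  obtain ⟨d, h1, h2⟩ := hL.exists_dim_eq hP hQ hT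
  obtain ⟨hTN, hPT, -⟩ := (mem_skewCorner_iff hP hQ).1 hT
  have hMc := isClosed_map_of_bound hL.isClosed hL.bound
  have hMaff := hL.affiliated.map hTN
  have hMP : L.map T.toLinearMap ≤ P.range := map_le_range hPT
  have hE := (IsAffiliated.range hP.1).inf hMaff.orthogonal
  have h3 := hL.dim_codomain
  set M := L.map T.toLinearMap
  have : CompleteSpace M := hMc.completeSpace_coe
  have : CompleteSpace (P.range ⊓ Mᗮ : Submodule ℂ H) :=
    (hP.isClosed_range.inter M.isClosed_orthogonal).completeSpace_coe
  have : CompleteSpace P.range := hP.isClosed_range.completeSpace_coe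
  have hPp : P = P.range.starProjection :=
    (isStarProjection_iff_eq_starProjection_range.1 hP.2).2
  refine ⟨hT, ?_, ?_, (P.range ⊓ Mᗮ).starProjection,
    ⟨hE.starProjection_mem, isStarProjection_starProjection⟩, ?_, ?_, ?_⟩
  · exact lt_of_le_of_lt (le_self_add.trans h1.ge) hL.dim_domain
  · exact lt_of_le_of_lt (le_add_self.trans h2.ge) hL.dim_codomain
  · exact (Submodule.starProjection_le_starProjection_iff.2 inf_le_left).trans_eq hPp.symm
  · rwa [← dim_eq_of_hasOrthogonalProjection]
  · rintro _ ⟨v, rfl⟩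
    have hv : P v - (P.range ⊓ Mᗮ).starProjection v = M.starProjection v := by
      rw [sub_eq_iff_eq_add, ← sub_eq_iff_eq_add', eq_comm]
      refine Submodule.eq_starProjection_of_mem_of_inner_eq_zero ⟨?_, ?_⟩ fun w hw => ?_
      · exact sub_mem ⟨v, rfl⟩ (hMP (Submodule.starProjection_apply_mem _ _))
      · intro w hw
        have e1 := Submodule.starProjection_inner_eq_zero (K := P.range) v w (hMP hw)
        have e2 := Submodule.starProjection_inner_eq_zero (K := M) v w hw
        rw [← hPp] at e1
        have : ⟪P v - M.starProjection v, w⟫_ℂ = 0 := by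
          rw [← sub_sub_sub_cancel_left _ _ v, inner_sub_left, e1, e2, sub_zero]
        exact inner_eq_zero_symm.1 this
      · have e1 := Submodule.starProjection_inner_eq_zero (K := P.range) v w hw.1
        rw [← hPp] at e1
        rw [← sub_add, inner_add_left, e1, hw.2 _ (Submodule.starProjection_apply_mem _ _),
          add_zero]
    obtain ⟨l, -, hl⟩ := Submodule.starProjection_apply_mem M v
    exact ⟨l, hl.trans hv.symm⟩

lemma IsRegularSubspace.index_eq (hP : IsProj N P) (hQ : IsProj N Q)
    (hT : T ∈ skewCorner P Q (N : Set (H →L[ℂ] H))) (hL : IsRegularSubspace τ P Q T L) :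
    index τ P Q T = (dim τ (Q.range ⊓ Lᗮ)).toReal -
      (dim τ (P.range ⊓ (L.map T.toLinearMap)ᗮ)).toReal := by
  obtain ⟨d, h1, h2⟩ := hL.exists_dim_eq hP hQ hT
  have h3 := hL.dim_domain
  have h4 := hL.dim_codomain
  rw [h1, ENNReal.add_lt_top] at h3
  rw [h2, ENNReal.add_lt_top] at h4
  rw [h1, h2, ENNReal.toReal_add h3.1.ne h3.2.ne, ENNReal.toReal_add h4.1.ne h4.2.ne]
  change (dim τ (T.ker ⊓ Q.range)).toReal - (dim τ ((star T).ker ⊓ P.range)).toReal = _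
  ring

/-- Every Fredholm operator has a regular subspace: the part orthogonal to the kernel of the
preimage of the range of `P - E`. -/
lemma IsFredholm.exists_isRegularSubspace (hP : IsProj N P) (hQ : IsProj N Q)
    (hT : IsFredholm τ P Q T) : ∃ L, IsRegularSubspace τ P Q T L := by
  obtain ⟨hTc, hker, -, E, hE, hEP, hEfin, hrange⟩ := hT
  obtain ⟨hTN, hPT, hTQ⟩ := (mem_skewCorner_iff hP hQ).1 hTc
  have hEP' : E * P = E := (hE.2.le_iff_mul_eq_left hP.2).1 hEP
  have hPE : P * E = E := by
    have := congrArg star hEP'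
    rwa [star_mul, hE.2.isSelfAdjoint.star_eq, hP.2.isSelfAdjoint.star_eq] at this
  have hEr := IsAffiliated.range hE.1
  have hQr := IsAffiliated.range hQ.1
  have hETN : E * T ∈ N := mul_mem hE.1 hTN
  have hN0 : IsAffiliated N (T.ker ⊓ Q.range) := (IsAffiliated.ker hTN).inf hQr
  set N₀ := T.ker ⊓ Q.range with hN0def
  have hN0c : IsClosed (N₀ : Set H) := T.isClosed_ker.inter hQ.isClosed_range
  have : CompleteSpace N₀ := hN0c.completeSpace_coe
  set K := Q.range ⊓ (E * T).ker with hKdef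
  have hKaff : IsAffiliated N K := hQr.inf (IsAffiliated.ker hETN)
  have hKc : IsClosed (K : Set H) := hQ.isClosed_range.inter (E * T).isClosed_ker
  have hN0K : N₀ ≤ K := fun v hv => ⟨hv.2, by
    change E (T v) = 0
    rw [show T v = 0 from hv.1, map_zero]⟩
  set L := K ⊓ N₀ᗮ with hLdef
  have hLaff : IsAffiliated N L := hKaff.inf hN0.orthogonal
  have hLc : IsClosed (L : Set H) := hKc.inter N₀.isClosed_orthogonal
  have : CompleteSpace L := hLc.completeSpace_coe
  have hPEr : (P - E).range ≤ L.map T.toLinearMap := by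
    rintro w hw
    obtain ⟨u, hu⟩ := hrange hw
    have hu : T u = w := hu
    obtain ⟨z, hz⟩ := hw
    have hz : P z - E z = w := hz
    have hEw : E w = 0 := by
      have e1 := congrArg (fun f : H →L[ℂ] H => f z) hEP'
      have e2 := congrArg (fun f : H →L[ℂ] H => f z) hE.mul_self
      simp only [mul_apply_eq_comp] at e1 e2
      rw [← hz, map_sub, e1, e2, sub_self]
    have hTQu : T (Q u) = w := by
      rw [← hu]
      exact congrArg (fun f : H →L[ℂ] H => f u) hTQ
    set n := N₀.starProjection (Q u)
    have hn : n ∈ N₀ := Submodule.starProjection_apply_mem _ _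
    have hQuK : Q u ∈ K := ⟨⟨u, rfl⟩, by
      change E (T (Q u)) = 0
      rw [hTQu, hEw]⟩
    refine ⟨Q u - n, ⟨sub_mem hQuK (hN0K hn),
      Submodule.sub_starProjection_mem_orthogonal _⟩, ?_⟩
    change T (Q u - n) = w
    rw [map_sub, hTQu, show T n = 0 from hn.1, sub_zero]
  have hLPE : L.map T.toLinearMap = (P - E).range := by
    refine le_antisymm ?_ hPEr
    rintro _ ⟨l, hl, rfl⟩
    refine ⟨T l, ?_⟩
    change P (T l) - E (T l) = T l
    rw [show E (T l) = 0 from hl.1.2, sub_zero]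
    exact congrArg (fun f : H →L[ℂ] H => f l) hPT
  have hPEproj : IsProj N (P - E) := by
    refine ⟨sub_mem hP.1 hE.1, ?_, hP.2.isSelfAdjoint.sub hE.2.isSelfAdjoint⟩
    change (P - E) * (P - E) = P - E
    rw [mul_sub, sub_mul, sub_mul, hP.mul_self, hE.mul_self, hEP', hPE]
    abel
  refine ⟨L, hLaff, hLc, inf_le_left.trans inf_le_left, ?_, ?_, ?_⟩
  · -- `T` maps the Hilbert space `L` bijectively onto the closed range of `P - E`.
    set f : L →L[ℂ] H := T ∘L L.subtypeL
    have hinj : Function.Injective f := by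
      refine (injective_iff_map_eq_zero f).2 fun v hv => ?_
      have hv0 : (v : H) ∈ N₀ := ⟨hv, v.2.1.1⟩
      exact Subtype.ext (inner_self_eq_zero.1 (v.2.2 v hv0))
    have hcl : IsClosed (Set.range f) := by
      convert hPEproj.isClosed_range using 1
      rw [← hLPE]
      ext w
      simp [f]
    obtain ⟨c, hc⟩ := f.antilipschitz_of_injective_of_isClosed_range hinj hcl
    refine ⟨((c : ℝ) + 1)⁻¹, by positivity, fun v hv => ?_⟩
    have h1 := hc.le_mul_dist ⟨v, hv⟩ 0
    rw [map_zero, dist_zero_right, dist_zero_right] at h1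
    have h1 : ‖v‖ ≤ c * ‖T v‖ := h1
    rw [inv_mul_le_iff₀ (by positivity)]
    nlinarith [norm_nonneg (T v)]
  · -- `E T` embeds the complement of `L`, up to the kernel of `T`, into the range of `E`.
    have hA : IsAffiliated N (Q.range ⊓ Lᗮ) := hQr.inf hLaff.orthogonal
    have hAc : IsClosed ((Q.range ⊓ Lᗮ : Submodule ℂ H) : Set H) :=
      hQ.isClosed_range.inter L.isClosed_orthogonal
    rw [dim_eq_ker_add_map τ hA hAc hETN]
    refine ENNReal.add_lt_top.2 ⟨?_, ?_⟩
    · refine lt_of_le_of_lt (dim_mono τ (hA.inf (IsAffiliated.ker hETN)) hN0 ?_) hker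
      rintro v ⟨⟨hvQ, hvL⟩, hvE⟩
      set n := N₀.starProjection v
      have hn : n ∈ N₀ := Submodule.starProjection_apply_mem _ _
      have hl : v - n ∈ L := ⟨sub_mem ⟨hvQ, hvE⟩ (hN0K hn),
        Submodule.sub_starProjection_mem_orthogonal _⟩
      have h1 : ⟪v - n, v⟫_ℂ = 0 := hvL _ hl
      have h2 : ⟪v - n, n⟫_ℂ = 0 := inner_eq_zero_symm.1 (hl.2 n hn)
      have h3 : v - n = 0 := by
        rw [← inner_self_eq_zero (𝕜 := ℂ), inner_sub_right, h1, h2, sub_zero]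
      rw [sub_eq_zero.1 h3]
      exact hn
    · refine lt_of_le_of_lt (dim_mono τ (hA.map hETN) hEr ?_)
        (lt_of_eq_of_lt (dim_range_of_isProj τ hE) hEfin)
      rintro _ ⟨v, -, rfl⟩
      exact ⟨T v, rfl⟩
  · rw [hLPE]
    refine lt_of_le_of_lt (dim_mono τ ((IsAffiliated.range hP.1).inf
      (IsAffiliated.range hPEproj.1).orthogonal) hEr ?_)
      (lt_of_eq_of_lt (dim_range_of_isProj τ hE) hEfin)
    rintro v ⟨hvP, hv⟩
    refine ⟨v, ?_⟩
    change E v = v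
    have hPv := hP.apply_of_mem hvP
    have h1 : P v - E v = 0 := by
      rw [← inner_self_eq_zero (𝕜 := ℂ)]
      have h2 : ⟪(P - E) ((P - E) v), v⟫_ℂ = 0 := hv _ ⟨_, rfl⟩
      rwa [← hPEproj.2.isSelfAdjoint.star_eq, ContinuousLinearMap.star_eq_adjoint,
        ContinuousLinearMap.adjoint_inner_left, ← ContinuousLinearMap.star_eq_adjoint,
        hPEproj.2.isSelfAdjoint.star_eq] at h2
    rw [hPv, sub_eq_zero] at h1
    exact h1.symm

/-! ### Small perturbations -/

lemma dim_inf_orthogonal_le (hP : IsProj N P) {M M' : Submodule ℂ H} (hM : IsAffiliated N M)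
    (hM' : IsAffiliated N M') (hM'c : IsClosed (M' : Set H)) (hM'P : M' ≤ P.range)
    (hdisj : ∀ v ∈ M', v ∈ Mᗮ → v = 0) :
    dim τ (P.range ⊓ Mᗮ) ≤ dim τ (P.range ⊓ M'ᗮ) := by
  have : CompleteSpace M' := hM'c.completeSpace_coe
  have hPr := IsAffiliated.range hP.1
  have hx : (1 - M'.starProjection) ∈ N := sub_mem (one_mem N) hM'.starProjection_mem
  have hA := hPr.inf hM.orthogonal
  refine (dim_le_map τ hA (hP.isClosed_range.inter M.isClosed_orthogonal) hx ?_).trans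
    (dim_mono τ (hA.map hx) (hPr.inf hM'.orthogonal) ?_)
  · rw [eq_bot_iff]
    rintro v ⟨⟨-, hv1⟩, hv2⟩
    have hv3 : v - M'.starProjection v = 0 := hv2
    refine hdisj v ?_ hv1
    rw [sub_eq_zero.1 hv3]
    exact Submodule.starProjection_apply_mem _ _
  · rintro _ ⟨v, ⟨hvP, -⟩, rfl⟩
    exact ⟨sub_mem hvP (hM'P (Submodule.starProjection_apply_mem _ _)),
      Submodule.sub_starProjection_mem_orthogonal _⟩

/-- A regular subspace for `T` is regular for every operator near `T`, with an image of the same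
codimension. -/
lemma IsRegularSubspace.exists_forall_near (hP : IsProj N P) (hQ : IsProj N Q)
    (hT : T ∈ skewCorner P Q (N : Set (H →L[ℂ] H))) (hL : IsRegularSubspace τ P Q T L) :
    ∃ δ : ℝ, 0 < δ ∧ ∀ S ∈ skewCorner P Q (N : Set (H →L[ℂ] H)), ‖T - S‖ < δ →
      IsRegularSubspace τ P Q S L ∧ dim τ (P.range ⊓ (L.map S.toLinearMap)ᗮ) =
        dim τ (P.range ⊓ (L.map T.toLinearMap)ᗮ) := by
  obtain ⟨hTN, hPT, -⟩ := (mem_skewCorner_iff hP hQ).1 hT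
  obtain ⟨c, hc, hb⟩ := hL.bound
  -- `S` is bounded below by `c / 2` on `L`, which exceeds `‖T - S‖`.
  refine ⟨c / 2, by positivity, fun S hS hTS => ?_⟩
  obtain ⟨hSN, hPS, -⟩ := (mem_skewCorner_iff hP hQ).1 hS
  have hbS : ∀ v ∈ L, c / 2 * ‖v‖ ≤ ‖S v‖ := fun v hv => by
    have h1 := hb v hv
    have h2 : ‖T v‖ - ‖S v‖ ≤ ‖T - S‖ * ‖v‖ :=
      (norm_sub_norm_le _ _).trans ((T - S).le_opNorm v)
    nlinarith [norm_nonneg v]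
  have hSb : ∃ c : ℝ, 0 < c ∧ ∀ v ∈ L, c * ‖v‖ ≤ ‖S v‖ := ⟨c / 2, by positivity, hbS⟩
  have haT := hL.affiliated.map hTN
  have haS := hL.affiliated.map hSN
  have hdim : dim τ (P.range ⊓ (L.map S.toLinearMap)ᗮ) =
      dim τ (P.range ⊓ (L.map T.toLinearMap)ᗮ) := by
    refine le_antisymm ?_ ?_
    · exact dim_inf_orthogonal_le hP haS haT (isClosed_map_of_bound hL.isClosed hL.bound)
        (map_le_range hPT) fun v hv hv' =>
          eq_zero_of_mem_map_of_orthogonal hb (hTS.trans (by linarith)) hv hv'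
    · exact dim_inf_orthogonal_le hP haT haS (isClosed_map_of_bound hL.isClosed hSb)
        (map_le_range hPS) fun v hv hv' =>
          eq_zero_of_mem_map_of_orthogonal hbS (by rwa [norm_sub_rev]) hv hv'
  exact ⟨⟨hL.affiliated, hL.isClosed, hL.le_range, hSb, hL.dim_domain,
    hdim.trans_lt hL.dim_codomain⟩, hdim⟩

theorem IsFredholm.exists_forall_near (hP : IsProj N P) (hQ : IsProj N Q)
    (hT : IsFredholm τ P Q T) :
    ∃ δ : ℝ, 0 < δ ∧ ∀ S ∈ skewCorner P Q (N : Set (H →L[ℂ] H)), ‖T - S‖ < δ →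
      IsFredholm τ P Q S ∧ index τ P Q S = index τ P Q T := by
  obtain ⟨L, hL⟩ := hT.exists_isRegularSubspace hP hQ
  obtain ⟨δ, hδ, h⟩ := hL.exists_forall_near hP hQ hT.1
  refine ⟨δ, hδ, fun S hS hTS => ?_⟩
  obtain ⟨hLS, hdim⟩ := h S hS hTS
  exact ⟨hLS.isFredholm hP hQ hS,
    by rw [hLS.index_eq hP hQ hS, hL.index_eq hP hQ hT.1, hdim]⟩

/-! ### Perturbations of finite-dimensional range -/

/-- Cutting a subspace by the kernel of an operator of finite-dimensional range changes its
codimension by a finite amount. -/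
lemma dim_inf_orthogonal_inf_ker_lt_top (hF : F ∈ N) (hFfin : dim τ F.range < ∞)
    (hL : IsAffiliated N L) (hLc : IsClosed (L : Set H)) :
    dim τ (L ⊓ (L ⊓ F.ker)ᗮ) < ∞ := by
  have hA := hL.inf (hL.inf (IsAffiliated.ker hF)).orthogonal
  refine lt_of_le_of_lt ((dim_le_map τ hA (hLc.inter (Submodule.isClosed_orthogonal _)) hF
    ?_).trans (dim_mono τ (hA.map hF) (IsAffiliated.range hF) ?_)) hFfin
  · rw [eq_bot_iff]
    rintro v ⟨⟨hv1, hv2⟩, hv3⟩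
    exact inner_self_eq_zero.1 (hv2 v ⟨hv1, hv3⟩)
  · rintro _ ⟨v, -, rfl⟩
    exact ⟨v, rfl⟩

/-- Finite codimension is transitive. -/
lemma dim_inf_orthogonal_lt_top_trans {R : Submodule ℂ H} (hR : IsAffiliated N R)
    (hRc : IsClosed (R : Set H)) (hL : IsAffiliated N L) (hLc : IsClosed (L : Set H))
    (hK : IsAffiliated N K) (hLR : L ≤ R) (h1 : dim τ (R ⊓ Lᗮ) < ∞) (h2 : dim τ (L ⊓ Kᗮ) < ∞) :
    dim τ (R ⊓ Kᗮ) < ∞ := by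
  have : CompleteSpace L := hLc.completeSpace_coe
  have hx : (1 - L.starProjection) ∈ N := sub_mem (one_mem N) hL.starProjection_mem
  have hA := hR.inf hK.orthogonal
  rw [dim_eq_ker_add_map τ hA (hRc.inter K.isClosed_orthogonal) hx]
  refine ENNReal.add_lt_top.2 ⟨lt_of_le_of_lt (dim_mono τ (hA.inf (IsAffiliated.ker hx))
    (hL.inf hK.orthogonal) ?_) h2, lt_of_le_of_lt (dim_mono τ (hA.map hx)
    (hR.inf hL.orthogonal) ?_) h1⟩
  · rintro v ⟨⟨-, hv1⟩, hv2⟩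
    have hv3 : v - L.starProjection v = 0 := hv2
    refine ⟨?_, hv1⟩
    rw [sub_eq_zero.1 hv3]
    exact Submodule.starProjection_apply_mem _ _
  · rintro _ ⟨v, ⟨hvR, -⟩, rfl⟩
    exact ⟨sub_mem hvR (hLR (Submodule.starProjection_apply_mem _ _)),
      Submodule.sub_starProjection_mem_orthogonal _⟩

/-- The codimension of `T K` in `T L` is at most that of `K` in `L`. -/
lemma dim_map_inf_orthogonal_map_le (hT : T ∈ N) (hL : IsAffiliated N L)
    (hLc : IsClosed (L : Set H)) (hK : IsAffiliated N K) (hKc : IsClosed (K : Set H))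
    (hKL : K ≤ L) :
    dim τ (L.map T.toLinearMap ⊓ (K.map T.toLinearMap)ᗮ) ≤ dim τ (L ⊓ Kᗮ) := by
  have : CompleteSpace K := hKc.completeSpace_coe
  have hMaff := hK.map hT
  set M := (K.map T.toLinearMap).topologicalClosure with hMdef
  have hx : (1 - M.starProjection) * T ∈ N :=
    mul_mem (sub_mem (one_mem N) hMaff.topologicalClosure.starProjection_mem) hT
  have hA := hL.inf hK.orthogonal
  refine (dim_mono τ ((hL.map hT).inf hMaff.orthogonal) (hA.map hx) ?_).trans
    (dim_map_le τ hA (hLc.inter K.isClosed_orthogonal) hx)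
  rintro _ ⟨⟨l, hl, rfl⟩, hg⟩
  have hk := Submodule.starProjection_apply_mem K l
  refine ⟨l - K.starProjection l, ⟨sub_mem hl (hKL hk),
    Submodule.sub_starProjection_mem_orthogonal _⟩, ?_⟩
  change T (l - K.starProjection l) - M.starProjection (T (l - K.starProjection l)) = T l
  have h1 : M.starProjection (T (K.starProjection l)) = T (K.starProjection l) :=
    Submodule.starProjection_eq_self_iff.2 (Submodule.le_topologicalClosure _ ⟨_, hk, rfl⟩)
  have h2 : M.starProjection (T l) = 0 := by
    refine (Submodule.starProjection_apply_eq_zero_iff M).2 ?_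
    rw [hMdef, Submodule.orthogonal_closure]
    exact hg
  rw [map_sub, map_sub, h1, h2]
  abel

/-- Regular subspaces may be cut by the kernel of an operator of finite-dimensional range. -/
lemma IsRegularSubspace.inf_ker (hP : IsProj N P) (hQ : IsProj N Q)
    (hT : T ∈ skewCorner P Q (N : Set (H →L[ℂ] H))) (hL : IsRegularSubspace τ P Q T L)
    (hF : F ∈ N) (hFfin : dim τ F.range < ∞) : IsRegularSubspace τ P Q T (L ⊓ F.ker) := by
  obtain ⟨hTN, hPT, -⟩ := (mem_skewCorner_iff hP hQ).1 hT
  have hK := hL.affiliated.inf (IsAffiliated.ker hF)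
  have hKc : IsClosed ((L ⊓ F.ker : Submodule ℂ H) : Set H) := hL.isClosed.inter F.isClosed_ker
  have hfin := dim_inf_orthogonal_inf_ker_lt_top hF hFfin hL.affiliated hL.isClosed
  refine ⟨hK, hKc, inf_le_left.trans hL.le_range, ?_, ?_, ?_⟩
  · obtain ⟨c, hc, hb⟩ := hL.bound
    exact ⟨c, hc, fun v hv => hb v hv.1⟩
  · exact dim_inf_orthogonal_lt_top_trans (IsAffiliated.range hQ.1) hQ.isClosed_range
      hL.affiliated hL.isClosed hK hL.le_range hL.dim_domain hfin
  · exact dim_inf_orthogonal_lt_top_trans (IsAffiliated.range hP.1) hP.isClosed_range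
      (hL.affiliated.map hTN) (isClosed_map_of_bound hL.isClosed hL.bound) (hK.map hTN)
      (map_le_range hPT) hL.dim_codomain
      ((dim_map_inf_orthogonal_map_le hTN hL.affiliated hL.isClosed hK hKc inf_le_left).trans_lt
        hfin)

theorem IsFredholm.add_of_dim_range_lt_top (hP : IsProj N P) (hQ : IsProj N Q)
    (hT : IsFredholm τ P Q T) (hF : F ∈ skewCorner P Q (N : Set (H →L[ℂ] H)))
    (hFfin : dim τ F.range < ∞) :
    IsFredholm τ P Q (T + F) ∧ index τ P Q (T + F) = index τ P Q T := by
  obtain ⟨L, hL⟩ := hT.exists_isRegularSubspace hP hQ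
  have hK := hL.inf_ker hP hQ hT.1 ((mem_skewCorner_iff hP hQ).1 hF).1 hFfin
  set K := L ⊓ F.ker
  -- `T` and `T + F` agree on `K`.
  have hTF : ∀ v ∈ K, (T + F) v = T v := fun v hv => by
    rw [add_apply, show F v = 0 from hv.2, add_zero]
  have hmap : K.map (T + F).toLinearMap = K.map T.toLinearMap := by
    ext w
    constructor
    · rintro ⟨v, hv, rfl⟩
      exact ⟨v, hv, (hTF v hv).symm⟩
    · rintro ⟨v, hv, rfl⟩
      exact ⟨v, hv, hTF v hv⟩
  have hTFc := add_mem_skewCorner hP hQ hT.1 hF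
  have hK' : IsRegularSubspace τ P Q (T + F) K := by
    refine ⟨hK.affiliated, hK.isClosed, hK.le_range, ?_, hK.dim_domain, ?_⟩
    · obtain ⟨c, hc, hb⟩ := hK.bound
      exact ⟨c, hc, fun v hv => by rw [hTF v hv]; exact hb v hv⟩
    · rw [hmap]
      exact hK.dim_codomain
  exact ⟨hK'.isFredholm hP hQ hTFc,
    by rw [hK'.index_eq hP hQ hTFc, hK.index_eq hP hQ hT.1, hmap]⟩

/-! ### Compact perturbations -/

lemma isClosed_coe (N : VonNeumannAlgebra H) : IsClosed (N : Set (H →L[ℂ] H)) := by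
  rw [← VonNeumannAlgebra.centralizer_centralizer N]
  exact Set.isClosed_centralizer _

lemma dim_range_add_lt_top (hx : x ∈ N) (hF : F ∈ N) (hxfin : dim τ x.range < ∞)
    (hFfin : dim τ F.range < ∞) : dim τ (x + F).range < ∞ := by
  have hk : x.ker ⊓ F.ker ≤ (x + F).ker := fun v hv => by
    change x v + F v = 0
    rw [show x v = 0 from hv.1, show F v = 0 from hv.2, add_zero]
  have hkx := IsAffiliated.ker hx
  have hkF := IsAffiliated.ker hF
  rw [dim_range τ (add_mem hx hF)]
  refine (dim_mono τ (IsAffiliated.ker (add_mem hx hF)).orthogonal (hkx.inf hkF).orthogonal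
    (Submodule.orthogonal_le hk)).trans_lt ?_
  have h := dim_inf_orthogonal_lt_top_trans (τ := τ) (R := ⊤) (L := x.ker) (K := x.ker ⊓ F.ker)
    (fun _ _ _ _ => trivial) isClosed_univ hkx x.isClosed_ker (hkx.inf hkF) le_top
    (by rwa [top_inf_eq, ← dim_range τ hx])
    (dim_inf_orthogonal_inf_ker_lt_top hF hFfin hkx x.isClosed_ker)
  rwa [top_inf_eq] at h

lemma dim_range_mul_le_right (hx : x ∈ N) (hF : F ∈ N) :
    dim τ (x * F).range ≤ dim τ F.range := by
  rw [dim_range τ (mul_mem hx hF), dim_range τ hF]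
  refine dim_mono τ (IsAffiliated.ker (mul_mem hx hF)).orthogonal
    (IsAffiliated.ker hF).orthogonal (Submodule.orthogonal_le fun v hv => ?_)
  change x (F v) = 0
  rw [show F v = 0 from hv, map_zero]

lemma dim_range_mul_le_left (hx : x ∈ N) (hF : F ∈ N) :
    dim τ (F * x).range ≤ dim τ F.range := by
  refine dim_mono τ (IsAffiliated.range (mul_mem hF hx)) (IsAffiliated.range hF) ?_
  rintro _ ⟨v, rfl⟩
  exact ⟨x v, rfl⟩

lemma mem_and_dim_range_lt_top_of_mem_span
    (hx : x ∈ Submodule.span ℂ {x : H →L[ℂ] H |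
      ∃ a ∈ N, ∃ b ∈ N, ∃ E, IsProj N E ∧ τ E < ∞ ∧ x = a * E * b}) :
    x ∈ N ∧ dim τ x.range < ∞ := by
  induction hx using Submodule.span_induction with
  | mem x hx =>
    obtain ⟨a, ha, b, hb, E, hE, hEfin, rfl⟩ := hx
    refine ⟨mul_mem (mul_mem ha hE.1) hb, ?_⟩
    refine (dim_range_mul_le_left hb (mul_mem ha hE.1)).trans_lt
      ((dim_range_mul_le_right ha hE.1).trans_lt ?_)
    rwa [dim_range_of_isProj τ hE]
  | zero =>
    refine ⟨zero_mem N, ?_⟩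
    have : (0 : H →L[ℂ] H).range = ⊥ := LinearMap.range_zero
    rw [this, dim_bot]
    exact ENNReal.zero_lt_top
  | add x y _ _ hx hy => exact ⟨add_mem hx.1 hy.1, dim_range_add_lt_top hx.1 hy.1 hx.2 hy.2⟩
  | smul c x _ hx =>
    have hc : c • (1 : H →L[ℂ] H) ∈ N := N.toStarSubalgebra.smul_mem (one_mem N) c
    have h : c • x = c • (1 : H →L[ℂ] H) * x := by rw [smul_mul_assoc, one_mul]
    rw [h]
    exact ⟨mul_mem hc hx.1, (dim_range_mul_le_right hc hx.1).trans_lt hx.2⟩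

theorem IsFredholm.add_of_mem_compacts (hP : IsProj N P) (hQ : IsProj N Q)
    (hT : IsFredholm τ P Q T) {k : H →L[ℂ] H} (hk : k ∈ skewCorner P Q (compacts τ)) :
    IsFredholm τ P Q (T + k) ∧ index τ P Q (T + k) = index τ P Q T := by
  obtain ⟨A, hA, rfl⟩ := hk
  obtain ⟨δ, hδ, hnear⟩ := hT.exists_forall_near hP hQ
  have hAN : A ∈ N :=
    closure_minimal (fun x hx => (mem_and_dim_range_lt_top_of_mem_span hx).1) (isClosed_coe N) hA
  -- Split `P A Q` into a part of small norm and a part of finite-dimensional range.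
  obtain ⟨f, hf, hAf⟩ := Metric.mem_closure_iff.1 hA δ hδ
  obtain ⟨hfN, hffin⟩ := mem_and_dim_range_lt_top_of_mem_span hf
  have hnorm : ‖P * (A - f) * Q‖ < δ := by
    rw [dist_eq_norm] at hAf
    have hP1 : ‖P‖ ≤ 1 := hP.2.norm_le
    have hQ1 : ‖Q‖ ≤ 1 := hQ.2.norm_le
    calc ‖P * (A - f) * Q‖ ≤ ‖P‖ * ‖A - f‖ * ‖Q‖ := norm_mul₃_le
      _ ≤ 1 * ‖A - f‖ * 1 := by gcongr
      _ < δ := by simpa using hAf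
  have hsmall : P * (A - f) * Q ∈ skewCorner P Q (N : Set (H →L[ℂ] H)) :=
    ⟨A - f, sub_mem hAN hfN, rfl⟩
  obtain ⟨h1, h2⟩ := hnear (T + P * (A - f) * Q) (add_mem_skewCorner hP hQ hT.1 hsmall)
    (by rwa [sub_add_cancel_left, norm_neg])
  obtain ⟨h3, h4⟩ := h1.add_of_dim_range_lt_top hP hQ (F := P * f * Q) ⟨f, hfN, rfl⟩
    ((dim_range_mul_le_left hQ.1 (mul_mem hP.1 hfN)).trans_lt
      ((dim_range_mul_le_right hP.1 hfN).trans_lt hffin))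
  have hsum : T + P * (A - f) * Q + P * f * Q = T + P * A * Q := by
    rw [mul_sub, sub_mul]
    abel
  rw [hsum] at h3 h4
  exact ⟨h3, h4.trans h2⟩

end Fredholm

end SkewFredholm

theorem corollary3p8 {H : Type*} [NormedAddCommGroup H] [InnerProductSpace ℂ H] [CompleteSpace H]
    (N : VonNeumannAlgebra H) (τ : SkewFredholm.FNSTrace N) (P Q : H →L[ℂ] H)
    (hP : SkewFredholm.IsProj N P) (hQ : SkewFredholm.IsProj N Q)
    (T : H →L[ℂ] H) (hT : SkewFredholm.IsFredholm τ P Q T) :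
    (∃ δ : ℝ, 0 < δ ∧ ∀ S ∈ SkewFredholm.skewCorner P Q (N : Set (H →L[ℂ] H)), ‖T - S‖ < δ →
      SkewFredholm.IsFredholm τ P Q S ∧
        SkewFredholm.index τ P Q S = SkewFredholm.index τ P Q T) ∧
    (∀ k ∈ SkewFredholm.skewCorner P Q (SkewFredholm.compacts τ),
      SkewFredholm.IsFredholm τ P Q (T + k) ∧
        SkewFredholm.index τ P Q (T + k) = SkewFredholm.index τ P Q T) := by
  exact ⟨hT.exists_forall_near hP hQ, fun _ hk => hT.add_of_mem_compacts hP hQ hk⟩
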